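/- Let $M,N,T$ be positive integers with $M\le\min\{N,\lfloor T/2\rfloor\}$ and put $L=\min\{N,T-M\}$. Write $\mathcal{CN}(0,\Sigma)$ for the circularly-symmetric complex Gaussian distribution with covariance $\Sigma$. A random $m\times m$ matrix has the complex Wishart distribution $\mathcal W_m(n,\Sigma)$ if it is distributed as $BB^{H}$, where the $n$ columns of the $m\times n$ matrix $B$ are independent and $\mathcal{CN}(0,\Sigma)$-distributed. It has the complex matrix-variate Beta distribution $\mathrm{Beta}_m(p,n)$ ($p,n>0$) if it is distributed as $(R^{H})^{-1}AR^{-1}$, where $A\sim\mathcal W_m(p,\Sigma)$ and $B\sim\mathcal W_m(n,\Sigma)$ are independent for some positive definite $\Sigma$, and $A+B=R^{H}R$ with $R$ upper triangular with positive diagonal entries. Let $D=\sqrt{TN/L}\,\operatorname{diag}(\tilde d_1,\dots,\tilde d_M)$ be a random $M\times M$ diagonal matrix with $\tilde d_1\ge\dots\ge\tilde d_M>0$ almost surely, such that - if $T<M+N$, then $(\tilde d_1^2,\dots,\tilde d_M^2)$ is distributed as the vector of decreasingly ordered eigenvalues of a $\mathrm{Beta}_M(T-M,\,M+N-T)$-distributed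 random matrix; - if $T\ge M+N$, then $\tilde d_1=\dots=\tilde d_M=1$ almost surely. Let $H$ be an $M\times N$ random matrix with i.i.d. $\mathcal{CN}(0,1)$ entries, independent of $D$, and let $G$ be an $M\times L$ random matrix with i.i.d. $\mathcal{CN}(0,TN/L)$ entries. Then the ordered singular values $(\sigma_1,\dots,\sigma_M)$ of $DH$ have the same joint distribution as the ordered singular values of $G$. -/

import Mathlib

open MeasureTheory ProbabilityTheory Matrix
open scoped NNReal

noncomputable section

/-- The entrywise (Borel) measurable structure on matrices. -/
instance Matrix.entrywiseMeasurableSpace {m n α : Type*} [MeasurableSpace α] :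
    MeasurableSpace (Matrix m n α) :=
  inferInstanceAs (MeasurableSpace (m → n → α))

/-- The circularly-symmetric complex Gaussian distribution `CN(0, v)` on `ℂ`: the real and imaginary
parts are independent real Gaussians of mean `0` and variance `v / 2`. -/
def complexGaussian (v : ℝ≥0) : Measure ℂ :=
  ((gaussianReal 0 (v / 2)).prod (gaussianReal 0 (v / 2))).map
    Complex.measurableEquivRealProd.symm

/-- The circularly-symmetric complex Gaussian distribution `CN(0, S)` on `ℂᵐ`, as the law of
`S ^ (1/2) z` where `z` has i.i.d. `CN(0, 1)` coordinates. This is meaningful for positive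
semidefinite `S`. -/
def complexGaussianVector {m : ℕ} (S : Matrix (Fin m) (Fin m) ℂ) : Measure (Fin m → ℂ) :=
  open scoped MatrixOrder ComplexOrder in
  (Measure.pi fun _ : Fin m => complexGaussian 1).map fun z => CFC.sqrt S *ᵥ z

/-- The complex Wishart distribution `W_m(n, S)`: the law of `B Bᴴ` where the `n` columns of the
`m × n` matrix `B` are independent and `CN(0, S)`-distributed. -/
def complexWishart {m : ℕ} (n : ℕ) (S : Matrix (Fin m) (Fin m) ℂ) :
    Measure (Matrix (Fin m) (Fin m) ℂ) :=
  (Measure.pi fun _ : Fin n => complexGaussianVector S).map fun c =>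
    (Matrix.of fun i k => c k i : Matrix (Fin m) (Fin n) ℂ) *
      (Matrix.of fun i k => c k i : Matrix (Fin m) (Fin n) ℂ)ᴴ

/-- `R` is upper triangular with positive diagonal entries and `Q = Rᴴ R`. -/
structure IsCholeskyFactor {m : ℕ} (R Q : Matrix (Fin m) (Fin m) ℂ) : Prop where
  upper : ∀ i j, j < i → R i j = 0
  diag_pos : ∀ i, 0 < (R i i).re ∧ (R i i).im = 0
  eq : Rᴴ * R = Q

/-- `ζ` is the complex matrix-variate Beta distribution `B_m(p, n)`: the law of `(Rᴴ)⁻¹ A R⁻¹`, where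
`A ∼ W_m(p, S)` and `B ∼ W_m(n, S)` are independent, for some (positive definite) covariance `S`, and
`A + B = Rᴴ R` with `R` upper triangular with positive diagonal entries. -/
def IsComplexMatrixBeta {m : ℕ} (p n : ℕ) (ζ : Measure (Matrix (Fin m) (Fin m) ℂ)) : Prop :=
  open scoped ComplexOrder in
  0 < p ∧ 0 < n ∧
  ∃ S : Matrix (Fin m) (Fin m) ℂ, S.PosDef ∧
  ∃ (Ω : Type) (_ : MeasurableSpace Ω) (P : Measure Ω) (_ : IsProbabilityMeasure P)
    (A B R : Ω → Matrix (Fin m) (Fin m) ℂ),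
    HasLaw A (complexWishart p S) P ∧ HasLaw B (complexWishart n S) P ∧ IndepFun A B P ∧
    AEMeasurable R P ∧ (∀ᵐ ω ∂P, IsCholeskyFactor (R ω) (A ω + B ω)) ∧
    HasLaw (fun ω => ((R ω)ᴴ)⁻¹ * A ω * (R ω)⁻¹) ζ P

/-- The eigenvalues of a Hermitian matrix in decreasing order, with multiplicity (and `0` for a
matrix that is not Hermitian). -/
def orderedEigenvalues {m : ℕ} (A : Matrix (Fin m) (Fin m) ℂ) : Fin m → ℝ :=
  open scoped Classical in
  if h : A.IsHermitian then fun i => h.eigenvalues₀ (Fin.cast (Fintype.card_fin m).symm i) else 0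

/-- The `m` largest singular values, in decreasing order, of an `m × n` matrix. For `m ≤ n` these are
all its singular values. -/
def orderedSingularValues {m n : ℕ} (A : Matrix (Fin m) (Fin n) ℂ) : Fin m → ℝ :=
  fun i => (Matrix.toEuclideanLin A).singularValues i

/-- The random matrix `X` has i.i.d. `CN(0, v)` entries. -/
def HasIIDComplexGaussianEntries {Ω : Type*} [MeasurableSpace Ω] {m n : ℕ}
    (X : Ω → Matrix (Fin m) (Fin n) ℂ) (v : ℝ≥0) (P : Measure Ω) : Prop :=
  iIndepFun (fun (q : Fin m × Fin n) (ω : Ω) => X ω q.1 q.2) P ∧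
    ∀ i j, HasLaw (fun ω => X ω i j) (complexGaussian v) P

/-- The random matrix `D` has the optimal diagonal distribution for `M` transmit antennas, `N`
receive antennas and coherence time `T`: almost surely `D = √(T N / L) diag(d)` with
`L = min {N, T - M}` and `d` ordered and positive, where
* if `T < M + N`, the squares of `d` are jointly distributed as the ordered eigenvalues of a
  `B_M(T - M, M + N - T)`-distributed random matrix;
* if `M + N ≤ T`, all the entries of `d` are almost surely `1`. -/
def HasOptimalDiagonalLaw {Ω : Type*} [MeasurableSpace Ω] (T M N : ℕ)
    (D : Ω → Matrix (Fin M) (Fin M) ℂ) (P : Measure Ω) : Prop :=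
  ∃ d : Ω → Fin M → ℝ, AEMeasurable d P ∧
    (∀ᵐ ω ∂P, Antitone (d ω) ∧ ∀ i, 0 < d ω i) ∧
    (∀ᵐ ω ∂P, D ω = Matrix.diagonal fun i =>
      ((√((T * N : ℝ) / (min N (T - M) : ℕ)) * d ω i : ℝ) : ℂ)) ∧
    (T < M + N → ∃ ζ : Measure (Matrix (Fin M) (Fin M) ℂ),
      IsComplexMatrixBeta (T - M) (M + N - T) ζ ∧
      IdentDistrib (fun ω i => d ω i ^ 2) orderedEigenvalues P ζ) ∧
    (M + N ≤ T → ∀ᵐ ω ∂P, ∀ i, d ω i = 1)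

end

/-! The squared singular values of `D H` are the spectrum of `Dᴴ D H Hᴴ = c diag(d²) H Hᴴ` with `c =
TN/L`, and those of `G` are distributed as the spectrum of `c Z Zᴴ` for a standard Gaussian `Z` with
`L` columns. If `M + N ≤ T`, then `d = 1` and `L = N`, so the two laws coincide. Otherwise `L = T -
M`, and the claim is that independent Beta eigenvalues thin an `N`-column Wishart matrix, at the
level of spectra, to a `(T - M)`-column one.

Let `Z` be standard Gaussian with `N` columns and let `E` select the first `T - M` of them. The Beta
eigenvalues are those of `(Z Zᴴ)⁻¹ (Z E)(Z E)ᴴ`. The law of `Z` is that of `Z O` with `O` an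
independent Haar unitary, and by polar decomposition `Z = S J W`, where `S² = Z Zᴴ`, `J` is fixed
with orthonormal rows and `W` is unitary. Given `Z`, the matrix `W O` is again Haar. Hence, with `K
= J O E`, the Beta spectrum has the law of that of `K Kᴴ` (`map_charpolyValues_beta`), while `(Z
E)(Z E)ᴴ` becomes `S K Kᴴ S`, isospectral to `K Kᴴ Z Zᴴ` with `K` independent of `Z`
(`map_charpolyValues_wishart`). Left unitary invariance of `Z` then replaces `K Kᴴ` by the diagonal
matrix of its eigenvalues, which gives `map_charpolyValues_diagonal_beta`.

Spectra are carried by the values of the characteristic polynomial at the natural numbers. These are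
continuous in the matrix and invariant under cyclic permutation of products, and the ordered
eigenvalues are a Borel function of them. No density is ever computed. -/

open scoped ComplexOrder

/-! ### Ordered spectra as Borel functions of characteristic polynomials -/

open Polynomial in
/-- A decreasing vector is determined by the monic polynomial of which it lists the roots. -/
theorem Antitone.eq_of_prod_X_sub_C_eq {n : ℕ} {v w : Fin n → ℝ} (hv : Antitone v)
    (hw : Antitone w)
    (h : ∏ i, (X - C (v i : ℂ)) = ∏ i, (X - C (w i : ℂ))) : v = w := by
  have key : ∀ u : Fin n → ℝ, Antitone u →
      ((∏ i, (X - C (u i : ℂ))).roots.map Complex.re).sort (· ≥ ·) = List.ofFn u := by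
    intro u hu
    rw [Polynomial.roots_prod _ _ (by simp [Finset.prod_ne_zero_iff, Polynomial.X_sub_C_ne_zero])]
    simp only [roots_X_sub_C, Multiset.bind_singleton, Fin.univ_val_map, Multiset.map_coe,
      List.map_ofFn, Function.comp_def, Complex.ofReal_re, Multiset.coe_sort]
    apply List.mergeSort_of_pairwise
    simp_rw [decide_eq_true_eq, ← List.sortedGE_iff_pairwise]
    exact hu.sortedGE_ofFn
  rw [← List.ofFn_inj, ← key v hv, ← key w hw, h]

/-- The values of the characteristic polynomial of a matrix at the natural numbers. -/
@[irreducible]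
noncomputable def Matrix.charpolyValues {n : Type*} [Fintype n] [DecidableEq n] (A : Matrix n n ℂ) :
    ℕ → ℂ :=
  fun k => A.charpoly.eval (k : ℂ)

section charpolyValues

variable {n : Type*} [Fintype n] [DecidableEq n]

theorem Matrix.charpolyValues_mul_comm (A B : Matrix n n ℂ) :
    (A * B).charpolyValues = (B * A).charpolyValues := by
  funext k
  rw [charpolyValues, charpolyValues, Matrix.charpoly_mul_comm A B]

theorem Matrix.charpolyValues_conj {U V : Matrix n n ℂ} (h : V * U = 1) (A : Matrix n n ℂ) :
    (U * A * V).charpolyValues = A.charpolyValues := by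
  rw [charpolyValues_mul_comm, ← mul_assoc, h, one_mul]

theorem Matrix.continuous_charpolyValues : Continuous (charpolyValues (n := n)) := by
  refine continuous_pi fun k => ?_
  simp only [charpolyValues, Matrix.eval_charpoly]
  exact (continuous_const.sub continuous_id).matrix_det

end charpolyValues

-- Infinitely many evaluation points determine a polynomial. Taking countably many keeps the space
-- of values a countable product, so that injective Borel maps into it are measurable embeddings.
open Polynomial in
theorem Polynomial.eq_of_eval_natCast_eq {p q : ℂ[X]} (h : ∀ k : ℕ, p.eval (k : ℂ) = q.eval (k : ℂ)) :
    p = q := by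
  refine Polynomial.eq_of_infinite_eval_eq p q ?_
  exact (Set.infinite_range_of_injective (Nat.cast_injective (R := ℂ))).mono
    (by rintro _ ⟨k, rfl⟩; exact h k)

/-- The decreasingly ordered real roots of a split polynomial are a measurable function of the
values of this polynomial. -/
theorem exists_measurable_orderedRoots (m : ℕ) :
    ∃ Φ : (ℕ → ℂ) → Fin m → ℝ, Measurable Φ ∧
      ∀ v : Fin m → ℝ, Antitone v → Φ (fun k => ∏ i, ((k : ℂ) - v i)) = v := by
  have hS : MeasurableSet {v : Fin m → ℝ | Antitone v} := by
    have : {v : Fin m → ℝ | Antitone v} = ⋂ i, ⋂ j, ⋂ _ : i ≤ j, {v | v j ≤ v i} := by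
      ext v; simp [Antitone]
    rw [this]
    refine .iInter fun i => .iInter fun j => .iInter fun _ => ?_
    exact measurableSet_le (measurable_pi_apply j) (measurable_pi_apply i)
  have := hS.standardBorel
  let ψ : {v : Fin m → ℝ | Antitone v} → ℕ → ℂ := fun v k => ∏ i, ((k : ℂ) - v.1 i)
  have hψ : Measurable ψ := by
    refine measurable_pi_lambda _ fun k => Finset.measurable_prod _ fun i _ => ?_
    have : Measurable fun v : {v : Fin m → ℝ | Antitone v} => v.1 i :=
      (measurable_pi_apply i).comp measurable_subtype_coe
    exact measurable_const.sub (Complex.measurable_ofReal.comp this)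
  have hinj : Function.Injective ψ := by
    intro v w h
    refine Subtype.ext (v.2.eq_of_prod_X_sub_C_eq w.2 (Polynomial.eq_of_eval_natCast_eq fun k => ?_))
    simpa [Polynomial.eval_prod] using congrFun h k
  -- Lusin–Souslin: an injective Borel map from a standard Borel space is a measurable embedding, so
  -- its inverse extends to a Borel map on all of `ℕ → ℂ`.
  obtain ⟨Φ, hΦ, hΦψ⟩ := (hψ.measurableEmbedding hinj).exists_measurable_extend
    (measurable_subtype_coe (p := fun v => v ∈ {v : Fin m → ℝ | Antitone v})) fun _ => ⟨0⟩
  exact ⟨Φ, hΦ, fun v hv => congrFun hΦψ ⟨v, hv⟩⟩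

/-! ### Ordered eigenvalues and singular values -/

open Polynomial in
theorem Matrix.IsHermitian.charpoly_eq_prod_orderedEigenvalues {m : ℕ}
    {A : Matrix (Fin m) (Fin m) ℂ} (hA : A.IsHermitian) :
    A.charpoly = ∏ i, (X - C (orderedEigenvalues A i : ℂ)) := by
  rw [hA.charpoly_eq]
  simp only [orderedEigenvalues, dif_pos hA]
  refine Fintype.prod_equiv ((Fintype.equivOfCardEq (Fintype.card_fin _)).symm.trans
    (finCongr (Fintype.card_fin m))) _ _ fun i => ?_
  simp [Matrix.IsHermitian.eigenvalues]

theorem Matrix.IsHermitian.antitone_orderedEigenvalues {m : ℕ}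
    {A : Matrix (Fin m) (Fin m) ℂ} (hA : A.IsHermitian) : Antitone (orderedEigenvalues A) := by
  simp only [orderedEigenvalues, dif_pos hA]
  intro i j h
  exact hA.eigenvalues₀_antitone (by simpa using h)

theorem Matrix.PosSemidef.orderedEigenvalues_nonneg {m : ℕ}
    {A : Matrix (Fin m) (Fin m) ℂ} (hA : A.PosSemidef) (i : Fin m) :
    0 ≤ orderedEigenvalues A i := by
  have := hA.eigenvalues_nonneg ((Fintype.equivOfCardEq (Fintype.card_fin _))
    (Fin.cast (Fintype.card_fin m).symm i))
  simpa [orderedEigenvalues, dif_pos hA.1, Matrix.IsHermitian.eigenvalues] using this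

open Polynomial in
/-- The squares of the singular values of `A` are the eigenvalues of `A Aᴴ`. -/
theorem orderedSingularValues_eq_sqrt {m n : ℕ} (hmn : m ≤ n) (A : Matrix (Fin m) (Fin n) ℂ) :
    orderedSingularValues A = fun i => √(orderedEigenvalues (A * Aᴴ) i) := by
  set T := Matrix.toEuclideanLin A
  have hT : (LinearMap.adjoint T ∘ₗ T).charpoly = (Aᴴ * A).charpoly := by
    rw [← Matrix.toEuclideanLin_conjTranspose_eq_adjoint, ← Matrix.toLpLin_mul_same,
      Matrix.toLpLin_eq_toLin, Matrix.charpoly_toLin]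
  have hpos : (A * Aᴴ).PosSemidef := Matrix.posSemidef_self_mul_conjTranspose A
  -- The spectrum of `Aᴴ A` is that of `A Aᴴ` padded with `n - m` zeros. Positivity puts the zeros
  -- last in decreasing order.
  set v : Fin n → ℝ := fun i => if h : (i : ℕ) < m then orderedEigenvalues (A * Aᴴ) ⟨i, h⟩ else 0
  have hv : Antitone v := by
    intro i j hij
    have hij' : (i : ℕ) ≤ j := hij
    simp only [v]
    split_ifs with h1 h2 h2
    · exact hpos.1.antitone_orderedEigenvalues hij
    · omega
    · exact hpos.orderedEigenvalues_nonneg _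
    · exact le_rfl
  have hfr := finrank_euclideanSpace_fin (𝕜 := ℂ) (n := n)
  have hw := T.isSymmetric_adjoint_comp_self.eigenvalues_antitone hfr
  have hprod : ∏ i, (X - C (v i : ℂ)) = X ^ (n - m) * (A * Aᴴ).charpoly := by
    rw [hpos.1.charpoly_eq_prod_orderedEigenvalues]
    obtain ⟨k, rfl⟩ := Nat.exists_eq_add_of_le hmn
    rw [Fin.prod_univ_add]
    simp [v, mul_comm]
  have hvw : T.isSymmetric_adjoint_comp_self.eigenvalues hfr = v := by
    refine hw.eq_of_prod_X_sub_C_eq hv ?_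
    have h := Matrix.charpoly_mul_comm_of_le Aᴴ A (by simpa using hmn)
    rw [Fintype.card_fin, Fintype.card_fin] at h
    rw [hprod, ← h, ← hT,
      T.isSymmetric_adjoint_comp_self.charpoly_eq hfr]
    rfl
  funext i
  rw [orderedSingularValues, T.singularValues_of_lt hfr (i.2.trans_le hmn), hvw]
  simp [v]

/-! ### Complex Gaussian matrices and their unitary invariance -/

instance Matrix.entrywiseBorelSpace {m n α : Type*} [Countable m] [Countable n] [TopologicalSpace α]
    [MeasurableSpace α] [SecondCountableTopology α] [BorelSpace α] : BorelSpace (Matrix m n α) :=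
  inferInstanceAs (BorelSpace (m → n → α))

instance Matrix.entrywiseSecondCountableTopology {m n α : Type*} [Countable m] [Countable n]
    [TopologicalSpace α] [SecondCountableTopology α] : SecondCountableTopology (Matrix m n α) :=
  inferInstanceAs (SecondCountableTopology (m → n → α))

instance isProbabilityMeasure_complexGaussian (v : ℝ≥0) :
    IsProbabilityMeasure (complexGaussian v) :=
  Measure.isProbabilityMeasure_map Complex.measurableEquivRealProd.symm.measurable.aemeasurable

theorem charFun_complexGaussian_one (t : ℂ) :
    charFun (complexGaussian 1) t = Complex.exp (-‖t‖ ^ 2 / 4) := by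
  rw [charFun_apply, complexGaussian, integral_map_equiv]
  have h : ∀ x : ℝ × ℝ, Complex.exp (inner ℝ (Complex.measurableEquivRealProd.symm x) t * Complex.I)
      = Complex.exp (t.re * x.1 * Complex.I) * Complex.exp (t.im * x.2 * Complex.I) := by
    rintro ⟨a, b⟩
    rw [← Complex.exp_add]
    congr 1
    simp [Complex.measurableEquivRealProd, Complex.inner]
    ring
  simp_rw [h]
  rw [integral_prod_mul (fun x : ℝ => Complex.exp (t.re * x * Complex.I))
    (fun x : ℝ => Complex.exp (t.im * x * Complex.I)), ← charFun_apply_real, ← charFun_apply_real,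
    charFun_gaussianReal, charFun_gaussianReal, ← Complex.exp_add]
  congr 1
  have h2 : (‖t‖ : ℂ) ^ 2 = t.re * t.re + t.im * t.im := by
    rw [← Complex.ofReal_pow, ← Complex.normSq_eq_norm_sq, Complex.normSq_apply]
    push_cast
    ring
  rw [h2]
  push_cast
  ring

theorem map_mul_complexGaussian_one (v : ℝ≥0) :
    (complexGaussian 1).map (fun z => ((√(v : ℝ) : ℝ) : ℂ) * z) = complexGaussian v := by
  have h : (gaussianReal 0 (1 / 2)).map (fun x => √(v : ℝ) * x) = gaussianReal 0 (v / 2) := by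
    rw [gaussianReal_map_const_mul]
    congr 1
    · simp
    · ext
      simp [div_eq_mul_inv]
  rw [complexGaussian, complexGaussian, ← h, Measure.map_prod_map _ _ (by fun_prop) (by fun_prop),
    Measure.map_map (by fun_prop) (by fun_prop), Measure.map_map (by fun_prop) (by fun_prop)]
  congr 1
  funext x
  apply Complex.ext <;> simp [Complex.measurableEquivRealProd]

section matrixGaussian

variable {ι κ : Type*} [Fintype ι] [Fintype κ]

/-- The law of an `ι × κ` matrix with i.i.d. `CN(0, v)` entries. -/
noncomputable def matrixGaussian (ι κ : Type*) [Fintype ι] [Fintype κ] (v : ℝ≥0) :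
    Measure (Matrix ι κ ℂ) :=
  (Measure.pi fun _ : ι × κ => complexGaussian v).map fun x => Matrix.of fun i j => x (i, j)

omit [Fintype ι] [Fintype κ] in
theorem Matrix.measurable_of_prod : Measurable fun x : ι × κ → ℂ => Matrix.of fun i j => x (i, j) :=
  measurable_pi_lambda _ fun i => measurable_pi_lambda _ fun j => measurable_pi_apply (i, j)

instance isProbabilityMeasure_matrixGaussian (v : ℝ≥0) :
    IsProbabilityMeasure (matrixGaussian ι κ v) :=
  Measure.isProbabilityMeasure_map Matrix.measurable_of_prod.aemeasurable

theorem HasIIDComplexGaussianEntries.aemeasurable {Ω : Type*} [MeasurableSpace Ω] {m n : ℕ}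
    {X : Ω → Matrix (Fin m) (Fin n) ℂ} {v : ℝ≥0} {P : Measure Ω}
    (hX : HasIIDComplexGaussianEntries X v P) : AEMeasurable X P :=
  aemeasurable_pi_lambda _ fun i => aemeasurable_pi_lambda _ fun j => (hX.2 i j).aemeasurable

theorem HasIIDComplexGaussianEntries.map_eq {Ω : Type*} [MeasurableSpace Ω] {m n : ℕ}
    {X : Ω → Matrix (Fin m) (Fin n) ℂ} {v : ℝ≥0} {P : Measure Ω} [IsProbabilityMeasure P]
    (hX : HasIIDComplexGaussianEntries X v P) :
    P.map X = matrixGaussian (Fin m) (Fin n) v := by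
  have hm : ∀ q : Fin m × Fin n, AEMeasurable (fun ω => X ω q.1 q.2) P :=
    fun q => (hX.2 q.1 q.2).aemeasurable
  have h := (iIndepFun_iff_map_fun_eq_pi_map hm).1 hX.1
  simp only [fun q : Fin m × Fin n => (hX.2 q.1 q.2).map_eq] at h
  rw [matrixGaussian, ← h, AEMeasurable.map_map_of_aemeasurable
    Matrix.measurable_of_prod.aemeasurable (aemeasurable_pi_lambda _ hm)]
  rfl

theorem map_smul_matrixGaussian_one (v : ℝ≥0) :
    (matrixGaussian ι κ 1).map (fun Z => ((√(v : ℝ) : ℝ) : ℂ) • Z) = matrixGaussian ι κ v := by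
  rw [matrixGaussian, matrixGaussian, ← map_mul_complexGaussian_one v,
    ← Measure.pi_map_pi fun _ => by fun_prop, Measure.map_map (by fun_prop) measurable_of_prod,
    Measure.map_map measurable_of_prod (by fun_prop)]
  rfl

/-- The characteristic function of the Gaussian law depends only on the Frobenius norm. Since `g` is
adjoint to `f` for the real Frobenius pairing and preserves the norm, pushing forward by `f` leaves
it unchanged. -/
theorem matrixGaussian_one_map_eq_self {f g : Matrix ι κ ℂ → Matrix ι κ ℂ} (hf : Measurable f)
    (hfg : ∀ Z T, (f Z * Tᴴ).trace.re = (Z * (g T)ᴴ).trace.re)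
    (hg : ∀ T, (g T * (g T)ᴴ).trace.re = (T * Tᴴ).trace.re) :
    (matrixGaussian ι κ 1).map f = matrixGaussian ι κ 1 := by
  let e : (PiLp 2 fun _ : ι × κ => ℂ) → Matrix ι κ ℂ := fun x => Matrix.of fun i j => x (i, j)
  have he : Measurable e := measurable_of_prod.comp (WithLp.measurable_ofLp 2 _)
  have hinner : ∀ x t : PiLp 2 fun _ : ι × κ => ℂ, inner ℝ x t = (e x * (e t)ᴴ).trace.re := by
    intro x t
    rw [PiLp.inner_apply, Fintype.sum_prod_type]
    simp [Complex.inner, Matrix.trace, Matrix.mul_apply, e, mul_comm]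
  have hγ : matrixGaussian ι κ 1 =
      ((Measure.pi fun _ : ι × κ => complexGaussian 1).map (WithLp.toLp 2)).map e := by
    rw [Measure.map_map he (WithLp.measurable_toLp 2 _)]
    rfl
  set ν : Measure (PiLp 2 fun _ : ι × κ => ℂ) :=
    (Measure.pi fun _ : ι × κ => complexGaussian 1).map (WithLp.toLp 2)
  have hchar : ∀ t, charFun ν t = Complex.exp (-(inner ℝ t t : ℝ) / 4) := by
    intro t
    rw [charFun_pi]
    simp_rw [charFun_complexGaussian_one]
    rw [← Complex.exp_sum, PiLp.inner_apply]
    simp only [real_inner_self_eq_norm_sq]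
    push_cast
    rw [← Finset.sum_div, Finset.sum_neg_distrib]
  let e' : Matrix ι κ ℂ → PiLp 2 fun _ : ι × κ => ℂ := fun Z => WithLp.toLp 2 fun q => Z q.1 q.2
  have he' : Measurable e' := (WithLp.measurable_toLp 2 _).comp (by fun_prop)
  have hee' : ∀ Z, e (e' Z) = Z := fun Z => rfl
  have hmap : ν.map (fun x => e' (f (e x))) = ν := by
    have : IsProbabilityMeasure ν :=
      Measure.isProbabilityMeasure_map (WithLp.measurable_toLp 2 _).aemeasurable
    refine Measure.ext_of_charFun (funext fun t => ?_)
    have hm : Measurable fun x => e' (f (e x)) := he'.comp (hf.comp he)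
    have h1 : charFun (ν.map (fun x => e' (f (e x)))) t = charFun ν (e' (g (e t))) := by
      rw [charFun_apply, charFun_apply, integral_map hm.aemeasurable
        (Measurable.aestronglyMeasurable (by fun_prop))]
      simp only [hinner, hee', hfg]
    rw [h1, hchar, hchar, hinner, hinner, hee', hg]
  rw [hγ]
  conv_rhs => rw [← hmap]
  rw [Measure.map_map hf he]
  exact (Measure.map_map he (he'.comp (hf.comp he))).symm

theorem matrixGaussian_one_map_mul_left [DecidableEq ι] (U : Matrix ι ι ℂ) (hU : Uᴴ * U = 1) :
    (matrixGaussian ι κ 1).map (fun Z => U * Z) = matrixGaussian ι κ 1 := by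
  refine matrixGaussian_one_map_eq_self (g := fun T => Uᴴ * T)
    (continuous_const.matrix_mul continuous_id).measurable (fun Z T => ?_) fun T => ?_
  · rw [Matrix.mul_assoc, Matrix.trace_mul_comm, conjTranspose_mul, conjTranspose_conjTranspose,
      Matrix.mul_assoc]
  · rw [Matrix.mul_assoc, Matrix.trace_mul_comm, conjTranspose_mul, conjTranspose_conjTranspose,
      Matrix.mul_assoc, Matrix.mul_assoc, mul_eq_one_comm.1 hU, Matrix.mul_one]

theorem matrixGaussian_one_map_mul_right [DecidableEq κ] (V : Matrix κ κ ℂ) (hV : Vᴴ * V = 1) :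
    (matrixGaussian ι κ 1).map (fun Z => Z * V) = matrixGaussian ι κ 1 := by
  refine matrixGaussian_one_map_eq_self (g := fun T => T * Vᴴ)
    (continuous_id.matrix_mul continuous_const).measurable (fun Z T => ?_) fun T => ?_
  · rw [conjTranspose_mul, conjTranspose_conjTranspose, Matrix.mul_assoc]
  · rw [conjTranspose_mul, conjTranspose_conjTranspose, Matrix.mul_assoc, ← Matrix.mul_assoc Vᴴ,
      hV, Matrix.one_mul]

/-- The column blocks of a Gaussian matrix are independent Gaussian matrices. -/
theorem matrixGaussian_map_toCols {κ' : Type*} [Fintype κ'] (v : ℝ≥0) :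
    (matrixGaussian ι (κ ⊕ κ') v).map (fun Z => (Z.toCols₁, Z.toCols₂)) =
      (matrixGaussian ι κ v).prod (matrixGaussian ι κ' v) := by
  let F : (ι × κ → ℂ) × (ι × κ' → ℂ) → ι × (κ ⊕ κ') → ℂ :=
    fun p q => Sum.elim (fun k => p.1 (q.1, k)) (fun k => p.2 (q.1, k)) q.2
  have hF : Measurable F := by
    refine measurable_pi_lambda _ fun q => ?_
    rcases q with ⟨i, k | k⟩
    · exact (measurable_pi_apply (i, k)).comp measurable_fst
    · exact (measurable_pi_apply (i, k)).comp measurable_snd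
  have h : (Measure.pi fun _ : ι × (κ ⊕ κ') => complexGaussian v) =
      ((Measure.pi fun _ : ι × κ => complexGaussian v).prod
        (Measure.pi fun _ : ι × κ' => complexGaussian v)).map F := by
    refine Measure.pi_eq fun s hs => ?_
    rw [Measure.map_apply hF (MeasurableSet.univ_pi hs)]
    have : F ⁻¹' Set.univ.pi s = (Set.univ.pi fun q : ι × κ => s (q.1, Sum.inl q.2)) ×ˢ
        (Set.univ.pi fun q : ι × κ' => s (q.1, Sum.inr q.2)) := by
      ext p
      simp [F, Set.mem_pi, forall_and]
    rw [this, Measure.prod_prod, Measure.pi_pi, Measure.pi_pi]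
    simp [Fintype.prod_prod_type, Finset.prod_mul_distrib]
  have hc : Measurable fun Z : Matrix ι (κ ⊕ κ') ℂ => (Z.toCols₁, Z.toCols₂) := by
    refine Measurable.prodMk ?_ ?_
    · exact measurable_pi_lambda _ fun i => measurable_pi_lambda _ fun j =>
        Measurable.comp (g := fun r : κ ⊕ κ' → ℂ => r (Sum.inl j)) (measurable_pi_apply _)
          (measurable_pi_apply i)
    · exact measurable_pi_lambda _ fun i => measurable_pi_lambda _ fun j =>
        Measurable.comp (g := fun r : κ ⊕ κ' → ℂ => r (Sum.inr j)) (measurable_pi_apply _)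
          (measurable_pi_apply i)
  rw [matrixGaussian, h, Measure.map_map measurable_of_prod hF,
    Measure.map_map hc (measurable_of_prod.comp hF), matrixGaussian, matrixGaussian,
    Measure.map_prod_map _ _ measurable_of_prod measurable_of_prod]
  rfl

/-- A matrix whose columns are i.i.d. vectors of i.i.d. Gaussian coordinates. -/
theorem map_pi_pi_complexGaussian (v : ℝ≥0) :
    (Measure.pi fun _ : κ => Measure.pi fun _ : ι => complexGaussian v).map
      (fun c => Matrix.of fun i k => c k i) = matrixGaussian ι κ v := by
  let F : (κ → ι → ℂ) → ι × κ → ℂ := fun c q => c q.2 q.1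
  have hF : Measurable F := by fun_prop
  have h : (Measure.pi fun _ : ι × κ => complexGaussian v) =
      (Measure.pi fun _ : κ => Measure.pi fun _ : ι => complexGaussian v).map F := by
    refine Measure.pi_eq fun s hs => ?_
    rw [Measure.map_apply hF (MeasurableSet.univ_pi hs)]
    have : F ⁻¹' Set.univ.pi s = Set.univ.pi fun k : κ => Set.univ.pi fun i : ι => s (i, k) := by
      ext p
      simp only [F, Set.mem_pi, Set.mem_preimage, Set.mem_univ, forall_const, Prod.forall]
      exact forall_comm
    rw [this]
    simp [Measure.pi_pi, Fintype.prod_prod_type_right]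
  rw [matrixGaussian, h, Measure.map_map measurable_of_prod hF]
  rfl

end matrixGaussian

theorem complexWishart_eq_map {m : ℕ} (n : ℕ) (S : Matrix (Fin m) (Fin m) ℂ) :
    complexWishart n S = (matrixGaussian (Fin m) (Fin n) 1).map fun Z =>
      (open scoped MatrixOrder in (CFC.sqrt S * Z) * (CFC.sqrt S * Z)ᴴ) := by
  have hs : Measurable fun z : Fin m → ℂ => (open scoped MatrixOrder in CFC.sqrt S *ᵥ z) :=
    (continuous_const.matrix_mulVec continuous_id).measurable
  have hm : Measurable fun c : Fin n → Fin m → ℂ =>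
      (Matrix.of fun i k => c k i : Matrix (Fin m) (Fin n) ℂ) :=
    measurable_pi_lambda _ fun i => measurable_pi_lambda _ fun k => by
      exact (measurable_pi_apply i).comp (measurable_pi_apply k)
  have hq : Measurable fun Z : Matrix (Fin m) (Fin n) ℂ => Z * Zᴴ :=
    (continuous_id.matrix_mul continuous_id.matrix_conjTranspose).measurable
  have hl : Measurable fun Z : Matrix (Fin m) (Fin n) ℂ =>
      (open scoped MatrixOrder in CFC.sqrt S * Z) :=
    (continuous_const.matrix_mul continuous_id).measurable
  rw [complexWishart]
  simp only [complexGaussianVector]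
  rw [← Measure.pi_map_pi fun _ => hs.aemeasurable, ← map_pi_pi_complexGaussian]
  exact (Measure.map_map (hq.comp hm) (by fun_prop)).trans
    (Measure.map_map (hq.comp hl) hm).symm

/-! ### Haar measure on the unitary group, orthonormal frames, polar decomposition -/

section unitary

variable {κ : Type*} [Fintype κ] [DecidableEq κ]

instance Matrix.compactSpace_unitaryGroup : CompactSpace (unitaryGroup κ ℂ) := by
  refine isCompact_iff_compactSpace.1 ?_
  have h : IsCompact (Set.univ.pi fun _ : κ => Set.univ.pi fun _ : κ => Metric.closedBall (0 : ℂ) 1) :=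
    isCompact_univ_pi fun _ => isCompact_univ_pi fun _ => isCompact_closedBall _ _
  refine IsCompact.of_isClosed_subset (X := Matrix κ κ ℂ) h isClosed_unitary fun U hU => ?_
  exact Set.mem_univ_pi.2 fun i => Set.mem_univ_pi.2 fun j =>
    mem_closedBall_zero_iff.2 (entry_norm_bound_of_unitary hU i j)

/-- There is an invariant probability measure on the unitary group. -/
theorem Matrix.exists_invariant_measure_unitaryGroup (κ : Type*) [Fintype κ] [DecidableEq κ] :
    ∃ μ : Measure (unitaryGroup κ ℂ), IsProbabilityMeasure μ ∧
      ∀ W : unitaryGroup κ ℂ, μ.map (fun O => W * O) = μ := by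
  have : IsTopologicalGroup (unitaryGroup κ ℂ) :=
    inferInstanceAs (IsTopologicalGroup (unitary (Matrix κ κ ℂ)))
  let μ : Measure (unitaryGroup κ ℂ) := Measure.haarMeasure ⊤
  refine ⟨μ, ⟨?_⟩, fun W => map_mul_left_eq_self μ W⟩
  simpa using Measure.haarMeasure_self (K₀ := (⊤ : TopologicalSpace.PositiveCompacts (unitaryGroup κ ℂ)))

/-- Orthonormal rows extend to a unitary matrix. -/
theorem Matrix.exists_unitary_submatrix_eq {ι : Type*} [Fintype ι] [DecidableEq ι] (f : ι → κ)
    (hf : Function.Injective f)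
    {V : Matrix ι κ ℂ} (hV : V * Vᴴ = 1) :
    ∃ B ∈ unitaryGroup κ ℂ, B.submatrix f id = V := by
  -- The inner product is conjugate-linear in its first slot, so the conjugated rows are the vectors
  -- whose Gram matrix is `V Vᴴ`.
  let w : κ → EuclideanSpace ℂ κ :=
    Function.extend f (fun i => WithLp.toLp 2 fun l => star (V i l)) 0
  have hwf : ∀ i, w (f i) = WithLp.toLp 2 fun l => star (V i l) := fun i => hf.extend_apply _ _ i
  have hw : Orthonormal ℂ ((Set.range f).domRestrict w) := by
    rw [orthonormal_iff_ite]
    rintro ⟨_, i, rfl⟩ ⟨_, j, rfl⟩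
    have := congrFun (congrFun hV i) j
    simp only [Set.domRestrict_apply, hwf, PiLp.inner_apply]
    by_cases hij : i = j
    · subst hij
      simpa [Matrix.mul_apply, Complex.mul_conj'] using this
    · rw [if_neg fun h => hij (hf (congrArg Subtype.val h))]
      simpa [Matrix.mul_apply, mul_comm, Matrix.one_apply, hij] using this
  obtain ⟨b, hb⟩ := hw.exists_orthonormalBasis_extension_of_card_eq (by simp)
  refine ⟨Matrix.of fun k l => star (b k l), ?_, ?_⟩
  · rw [mem_unitaryGroup_iff]
    ext k l
    have := orthonormal_iff_ite.1 b.orthonormal k l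
    rw [PiLp.inner_apply] at this
    rw [Matrix.one_apply, ← this]
    simp [Matrix.mul_apply, Matrix.star_apply, mul_comm]
  · ext i l
    have := congrArg (fun x : EuclideanSpace ℂ κ => star (x l)) (hb (f i) ⟨i, rfl⟩)
    simpa [hwf] using this

omit [DecidableEq κ] in
theorem Matrix.card_le_card_of_mul_conjTranspose_eq_one {ι : Type*} [Fintype ι] [DecidableEq ι]
    {V : Matrix ι κ ℂ} (hV : V * Vᴴ = 1) : Fintype.card ι ≤ Fintype.card κ := by
  have h := Matrix.rank_mul_le_left V Vᴴ
  rw [hV, Matrix.rank_one] at h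
  exact h.trans V.rank_le_card_width

/-- The unitary group acts transitively on the matrices with orthonormal rows. -/
theorem Matrix.exists_unitary_mul_eq {ι : Type*} [Fintype ι] [DecidableEq ι]
    {J V : Matrix ι κ ℂ} (hJ : J * Jᴴ = 1) (hV : V * Vᴴ = 1) :
    ∃ W : unitaryGroup κ ℂ, J * (W : Matrix κ κ ℂ) = V := by
  obtain ⟨f⟩ := Function.Embedding.nonempty_of_card_le (card_le_card_of_mul_conjTranspose_eq_one hV)
  obtain ⟨A, hA, rfl⟩ := exists_unitary_submatrix_eq f f.injective hJ
  obtain ⟨B, hB, rfl⟩ := exists_unitary_submatrix_eq f f.injective hV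
  refine ⟨⟨star A * B, mul_mem (Unitary.star_mem hA) hB⟩, ?_⟩
  change A.submatrix f id * (star A * B) = _
  have h1 : A * (star A * B) = B := by rw [← mul_assoc, Unitary.mul_star_self_of_mem hA, one_mul]
  conv_rhs => rw [← h1]
  rfl

omit [DecidableEq κ] in
open scoped MatrixOrder in
/-- Polar decomposition of a matrix of full row rank. -/
theorem Matrix.exists_polar {ι : Type*} [Fintype ι] [DecidableEq ι] {Z : Matrix ι κ ℂ}
    (hZ : IsUnit (Z * Zᴴ).det) :
    ∃ (S : Matrix ι ι ℂ) (V : Matrix ι κ ℂ), Sᴴ = S ∧ IsUnit S.det ∧ V * Vᴴ = 1 ∧ S * V = Z := by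
  have hpos : 0 ≤ Z * Zᴴ := Matrix.nonneg_iff_posSemidef.2 (posSemidef_self_mul_conjTranspose Z)
  set S := CFC.sqrt (Z * Zᴴ)
  have hS : S * S = Z * Zᴴ := CFC.sqrt_mul_sqrt_self _ hpos
  have hSH : Sᴴ = S := (Matrix.nonneg_iff_posSemidef.1 (CFC.sqrt_nonneg (Z * Zᴴ))).1
  have hdet : IsUnit S.det := by
    rw [← hS, det_mul] at hZ
    exact isUnit_of_mul_isUnit_left hZ
  refine ⟨S, S⁻¹ * Z, hSH, hdet, ?_, ?_⟩
  · rw [conjTranspose_mul, conjTranspose_nonsing_inv, hSH, Matrix.mul_assoc, ← Matrix.mul_assoc Z,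
      ← hS, Matrix.mul_assoc, mul_nonsing_inv _ hdet, mul_one, nonsing_inv_mul _ hdet]
  · rw [← Matrix.mul_assoc, mul_nonsing_inv _ hdet, Matrix.one_mul]

/-- Unitary diagonalization with ordered eigenvalues. -/
theorem Matrix.IsHermitian.exists_eq_conj_orderedEigenvalues {m : ℕ}
    {A : Matrix (Fin m) (Fin m) ℂ} (hA : A.IsHermitian) :
    ∃ U : Matrix (Fin m) (Fin m) ℂ, Uᴴ * U = 1 ∧
      A = U * diagonal (fun i => (orderedEigenvalues A i : ℂ)) * Uᴴ := by
  -- `eigenvalues` is indexed through an arbitrary bijection with `Fin (card)`; `σ` undoes it to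
  -- recover the decreasing order.
  let σ : Fin m ≃ Fin m := (Fintype.equivOfCardEq (Fintype.card_fin _)).symm.trans
    (finCongr (Fintype.card_fin m))
  have hσ : ∀ i, hA.eigenvalues i = orderedEigenvalues A (σ i) := by
    intro i
    simp [orderedEigenvalues, dif_pos hA, Matrix.IsHermitian.eigenvalues, σ]
  have h := hA.spectral_theorem
  set U : Matrix (Fin m) (Fin m) ℂ := (hA.eigenvectorUnitary : Matrix (Fin m) (Fin m) ℂ)
  have hU : Uᴴ * U = 1 := Unitary.star_mul_self_of_mem hA.eigenvectorUnitary.2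
  refine ⟨U.submatrix id σ.symm, ?_, ?_⟩
  · rw [conjTranspose_submatrix]
    refine (submatrix_mul Uᴴ U σ.symm id σ.symm Function.bijective_id).symm.trans ?_
    rw [hU, submatrix_one_equiv]
  · have hD : diagonal (fun i => (orderedEigenvalues A i : ℂ)) =
        (diagonal (fun i => (hA.eigenvalues i : ℂ))).submatrix σ.symm σ.symm := by
      rw [submatrix_diagonal_equiv]
      simp [hσ, Function.comp_def]
    rw [hD, conjTranspose_submatrix, submatrix_mul_equiv, submatrix_mul_equiv, submatrix_id_id]
    exact h.trans (Unitary.conjStarAlgAut_apply _ _)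

end unitary

/-! ### Push-forwards of product measures and measurability of matrix operations -/

/-- Conditioning on the first coordinate: equal conditional laws integrate to equal laws. This
allows `f` and `g` to differ by a transformation of `b` that depends on `a` in no measurable way,
such as the unitary `W` of a polar decomposition. -/
theorem MeasureTheory.Measure.map_prod_congr {α β γ : Type*} [MeasurableSpace α] [MeasurableSpace β]
    [MeasurableSpace γ] {μ : Measure α} {ν : Measure β} [SFinite μ] [SFinite ν]
    {f g : α × β → γ} (hf : Measurable f) (hg : Measurable g)
    (h : ∀ᵐ a ∂μ, ν.map (fun b => f (a, b)) = ν.map (fun b => g (a, b))) :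
    (μ.prod ν).map f = (μ.prod ν).map g := by
  ext s hs
  rw [Measure.map_apply hf hs, Measure.map_apply hg hs, Measure.prod_apply (hf hs),
    Measure.prod_apply (hg hs)]
  refine lintegral_congr_ae ?_
  filter_upwards [h] with a ha
  have := congrArg (fun ρ => ρ s) ha
  rwa [Measure.map_apply (by fun_prop) hs, Measure.map_apply (by fun_prop) hs] at this

theorem MeasureTheory.Measure.map_prod_comp_snd {α β γ : Type*} [MeasurableSpace α]
    [MeasurableSpace β] [MeasurableSpace γ] {μ : Measure α} {ν : Measure β} [IsProbabilityMeasure μ]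
    [SFinite ν] {f : β → γ} (hf : Measurable f) :
    (μ.prod ν).map (fun q => f q.2) = ν.map f := by
  refine (Measure.map_map hf measurable_snd).symm.trans ?_
  rw [Measure.map_snd_prod]
  simp

theorem MeasureTheory.Measure.map_comp_of_map_eq_self {α γ : Type*} [MeasurableSpace α]
    [MeasurableSpace γ] {μ : Measure α} {T : α → α} (hμ : μ.map T = μ) (hT : Measurable T)
    {f : α → γ} (hf : Measurable f) : μ.map (fun a => f (T a)) = μ.map f := by
  conv_rhs => rw [← hμ, Measure.map_map hf hT]
  rfl

/-- Inversion is not continuous at singular matrices, but the formula `det⁻¹ • adjugate`, with `0⁻¹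
= 0`, is Borel everywhere. -/
theorem Matrix.measurable_inv {n : Type*} [Fintype n] [DecidableEq n] :
    Measurable fun A : Matrix n n ℂ => A⁻¹ := by
  have h1 : Measurable fun A : Matrix n n ℂ => A.det := continuous_id.matrix_det.measurable
  have h2 : Measurable fun A : Matrix n n ℂ => A.adjugate := continuous_id.matrix_adjugate.measurable
  simp only [Matrix.inv_def, Ring.inverse_eq_inv']
  exact h1.inv.smul h2

theorem Measurable.matrix_mul {α l n p : Type*} [MeasurableSpace α] [Fintype n]
    {f : α → Matrix l n ℂ} {g : α → Matrix n p ℂ} (hf : Measurable f) (hg : Measurable g) :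
    Measurable fun a => f a * g a := by
  refine measurable_pi_lambda _ fun i => measurable_pi_lambda _ fun j => ?_
  refine Finset.measurable_sum _ fun k _ => Measurable.mul ?_ ?_
  · exact (measurable_pi_apply k).comp ((measurable_pi_apply i).comp hf)
  · exact (measurable_pi_apply j).comp ((measurable_pi_apply k).comp hg)

/-! ### Factorization of a Wishart spectrum into independent Beta and Wishart factors -/

section beta

variable {m : ℕ} {κ κ₁ : Type*} [Fintype κ] [DecidableEq κ] [Fintype κ₁]

/-- Randomizing a Gaussian matrix by an independent unitary matrix does not change its law. -/
theorem matrixGaussian_one_map_eq_map_prod {β : Type*} [MeasurableSpace β]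
    (μ : Measure (unitaryGroup κ ℂ)) [IsProbabilityMeasure μ]
    {f : Matrix (Fin m) κ ℂ → β} (hf : Measurable f) :
    ((matrixGaussian (Fin m) κ 1).prod μ).map (fun q => f (q.1 * (q.2 : Matrix κ κ ℂ))) =
      (matrixGaussian (Fin m) κ 1).map f := by
  set γ := matrixGaussian (Fin m) κ 1
  have hc : Continuous fun q : unitaryGroup κ ℂ × Matrix (Fin m) κ ℂ =>
      q.2 * (q.1 : Matrix κ κ ℂ) :=
    continuous_snd.matrix_mul (continuous_subtype_val.comp continuous_fst)
  have h1 : (μ.prod γ).map (fun q => f (q.2 * (q.1 : Matrix κ κ ℂ))) =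
      (μ.prod γ).map (fun q => f q.2) := by
    refine Measure.map_prod_congr (hf.comp hc.measurable) (hf.comp measurable_snd) (.of_forall fun O => ?_)
    have hO : (O : Matrix κ κ ℂ)ᴴ * O = 1 := Unitary.star_mul_self_of_mem O.2
    have hm : Measurable fun Z : Matrix (Fin m) κ ℂ => Z * (O : Matrix κ κ ℂ) :=
      (continuous_id.matrix_mul continuous_const).measurable
    exact Measure.map_comp_of_map_eq_self (matrixGaussian_one_map_mul_right _ hO) hm hf
  have hc' : Continuous fun q : Matrix (Fin m) κ ℂ × unitaryGroup κ ℂ =>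
      q.1 * (q.2 : Matrix κ κ ℂ) :=
    continuous_fst.matrix_mul (continuous_subtype_val.comp continuous_snd)
  rw [← Measure.prod_swap]
  refine (Measure.map_map (hf.comp hc'.measurable) measurable_swap).trans
    (h1.trans (Measure.map_prod_comp_snd hf))

omit [DecidableEq κ] in
theorem continuous_gram (E : Matrix κ κ₁ ℂ) :
    Continuous fun Z : Matrix (Fin m) κ ℂ => (Z * E) * (Z * E)ᴴ :=
  (continuous_id.matrix_mul continuous_const).matrix_mul
    (continuous_id.matrix_mul continuous_const).matrix_conjTranspose

omit [DecidableEq κ] in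
theorem measurable_charpolyValues_inv_mul (E : Matrix κ κ₁ ℂ) :
    Measurable fun Z : Matrix (Fin m) κ ℂ =>
      ((Z * Zᴴ)⁻¹ * ((Z * E) * (Z * E)ᴴ)).charpolyValues := by
  have h1 : Measurable fun Z : Matrix (Fin m) κ ℂ => (Z * Zᴴ)⁻¹ :=
    Matrix.measurable_inv.comp
      (continuous_id.matrix_mul continuous_id.matrix_conjTranspose).measurable
  exact continuous_charpolyValues.measurable.comp (h1.matrix_mul (continuous_gram E).measurable)

/-- If `Z` has full row rank and `J` has orthonormal rows, then `Z = S J W` with `S` Hermitian and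
`W` unitary. -/
theorem Matrix.exists_eq_hermitian_mul_mul_unitary {ι : Type*} [Fintype ι] [DecidableEq ι]
    {J : Matrix ι κ ℂ} (hJ : J * Jᴴ = 1) {Z : Matrix ι κ ℂ} (hZ : IsUnit (Z * Zᴴ).det) :
    ∃ (S : Matrix ι ι ℂ) (W : unitaryGroup κ ℂ), Sᴴ = S ∧ IsUnit S.det ∧
      Z * Zᴴ = S * S ∧ Z = S * (J * (W : Matrix κ κ ℂ)) := by
  obtain ⟨S, V, hS, hdet, hV, rfl⟩ := exists_polar hZ
  obtain ⟨W, hW⟩ := exists_unitary_mul_eq hJ hV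
  refine ⟨S, W, hS, hdet, ?_, by rw [hW]⟩
  rw [conjTranspose_mul, Matrix.mul_assoc, ← Matrix.mul_assoc V, hV, Matrix.one_mul, hS]

variable (μ : Measure (unitaryGroup κ ℂ)) [IsProbabilityMeasure μ]

/-- The compression of a randomly rotated projection is a matrix-variate beta matrix. -/
theorem map_charpolyValues_beta (hμ : ∀ W : unitaryGroup κ ℂ, μ.map (fun O => W * O) = μ)
    (E : Matrix κ κ₁ ℂ) {J : Matrix (Fin m) κ ℂ} (hJ : J * Jᴴ = 1)
    (hγ : ∀ᵐ Z ∂matrixGaussian (Fin m) κ 1, IsUnit (Z * Zᴴ).det) :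
    (matrixGaussian (Fin m) κ 1).map
        (fun Z => ((Z * Zᴴ)⁻¹ * ((Z * E) * (Z * E)ᴴ)).charpolyValues) =
      μ.map (fun O : unitaryGroup κ ℂ => ((J * (O : Matrix κ κ ℂ) * E) * (J * (O : Matrix κ κ ℂ) * E)ᴴ).charpolyValues) := by
  set γ := matrixGaussian (Fin m) κ 1
  have hJO : Continuous fun O : unitaryGroup κ ℂ => J * (O : Matrix κ κ ℂ) :=
    continuous_const.matrix_mul continuous_subtype_val
  have hK : Measurable fun O : unitaryGroup κ ℂ =>
      ((J * (O : Matrix κ κ ℂ) * E) * (J * (O : Matrix κ κ ℂ) * E)ᴴ).charpolyValues :=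
    (continuous_charpolyValues.comp ((continuous_gram E).comp hJO)).measurable
  have hmeas := measurable_charpolyValues_inv_mul (m := m) E
  rw [← matrixGaussian_one_map_eq_map_prod μ hmeas]
  have hc : Continuous fun q : Matrix (Fin m) κ ℂ × unitaryGroup κ ℂ =>
      q.1 * (q.2 : Matrix κ κ ℂ) :=
    continuous_fst.matrix_mul (continuous_subtype_val.comp continuous_snd)
  have h : (γ.prod μ).map (fun q : Matrix (Fin m) κ ℂ × unitaryGroup κ ℂ =>
      ((q.1 * (q.2 : Matrix κ κ ℂ) * (q.1 * (q.2 : Matrix κ κ ℂ))ᴴ)⁻¹ *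
        ((q.1 * (q.2 : Matrix κ κ ℂ) * E) * (q.1 * (q.2 : Matrix κ κ ℂ) * E)ᴴ)).charpolyValues) =
      (γ.prod μ).map (fun q =>
        ((J * (q.2 : Matrix κ κ ℂ) * E) * (J * (q.2 : Matrix κ κ ℂ) * E)ᴴ).charpolyValues) := by
    refine Measure.map_prod_congr (hmeas.comp hc.measurable) (hK.comp measurable_snd) ?_
    filter_upwards [hγ] with Z hZ
    obtain ⟨S, W, hS, hdet, hSS, hZW⟩ := exists_eq_hermitian_mul_mul_unitary hJ hZ
    -- For fixed `Z`, left invariance absorbs `W` into `O`, so the conditional law no longer depends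
    -- on `Z`.
    refine Eq.trans ?_ (Measure.map_comp_of_map_eq_self (hμ W) (measurable_const_mul W) hK)
    congr 1
    funext O
    have hO : (O : Matrix κ κ ℂ) * (O : Matrix κ κ ℂ)ᴴ = 1 := Unitary.mul_star_self_of_mem O.2
    have hQ : Z * (O : Matrix κ κ ℂ) * (Z * (O : Matrix κ κ ℂ))ᴴ = S * S := by
      rw [conjTranspose_mul, Matrix.mul_assoc, ← Matrix.mul_assoc (O : Matrix κ κ ℂ), hO,
        Matrix.one_mul, hSS]
    have hX : Z * (O : Matrix κ κ ℂ) * E = S * (J * ((W * O : unitaryGroup κ ℂ) : Matrix κ κ ℂ) * E) := by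
      rw [hZW]
      simp only [Submonoid.coe_mul, Matrix.mul_assoc]
    rw [hQ, hX, conjTranspose_mul, hS]
    set K := J * ((W * O : unitaryGroup κ ℂ) : Matrix κ κ ℂ) * E
    -- `(S S)⁻¹ (S K Kᴴ S) = S⁻¹ (K Kᴴ) S` is similar to `K Kᴴ`.
    rw [← Matrix.charpolyValues_conj (mul_nonsing_inv S hdet) (K * Kᴴ), Matrix.mul_inv_rev]
    simp only [Matrix.mul_assoc]
    rw [← Matrix.mul_assoc S⁻¹ S, nonsing_inv_mul _ hdet, Matrix.one_mul]
  exact h.trans (Measure.map_prod_comp_snd hK)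

/-- The law of the Wishart matrix as a product of independent beta and Wishart matrices. -/
theorem map_charpolyValues_wishart (hμ : ∀ W : unitaryGroup κ ℂ, μ.map (fun O => W * O) = μ)
    (E : Matrix κ κ₁ ℂ) {J : Matrix (Fin m) κ ℂ} (hJ : J * Jᴴ = 1) (c : ℂ)
    (hγ : ∀ᵐ Z ∂matrixGaussian (Fin m) κ 1, IsUnit (Z * Zᴴ).det) :
    (matrixGaussian (Fin m) κ 1).map (fun Z => (c • ((Z * E) * (Z * E)ᴴ)).charpolyValues) =
      ((matrixGaussian (Fin m) κ 1).prod μ).map (fun q =>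
        (c • ((J * (q.2 : Matrix κ κ ℂ) * E) * (J * (q.2 : Matrix κ κ ℂ) * E)ᴴ *
          (q.1 * q.1ᴴ))).charpolyValues) := by
  set γ := matrixGaussian (Fin m) κ 1
  have hmeas : Measurable fun Z : Matrix (Fin m) κ ℂ =>
      (c • ((Z * E) * (Z * E)ᴴ)).charpolyValues :=
    (continuous_charpolyValues.comp ((continuous_gram E).const_smul c)).measurable
  have hK : Continuous fun O : unitaryGroup κ ℂ =>
      (J * (O : Matrix κ κ ℂ) * E) * (J * (O : Matrix κ κ ℂ) * E)ᴴ :=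
    (continuous_gram E).comp (continuous_const.matrix_mul continuous_subtype_val)
  rw [← matrixGaussian_one_map_eq_map_prod μ hmeas]
  have hc : Continuous fun q : Matrix (Fin m) κ ℂ × unitaryGroup κ ℂ =>
      q.1 * (q.2 : Matrix κ κ ℂ) :=
    continuous_fst.matrix_mul (continuous_subtype_val.comp continuous_snd)
  have hg : Continuous fun q : Matrix (Fin m) κ ℂ × unitaryGroup κ ℂ =>
      (c • ((J * (q.2 : Matrix κ κ ℂ) * E) * (J * (q.2 : Matrix κ κ ℂ) * E)ᴴ *
          (q.1 * q.1ᴴ))).charpolyValues :=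
    continuous_charpolyValues.comp (((hK.comp continuous_snd).matrix_mul
      (continuous_fst.matrix_mul continuous_fst.matrix_conjTranspose)).const_smul c)
  refine Measure.map_prod_congr (hmeas.comp hc.measurable) hg.measurable ?_
  filter_upwards [hγ] with Z hZ
  obtain ⟨S, W, hS, hdet, hSS, hZW⟩ := exists_eq_hermitian_mul_mul_unitary hJ hZ
  refine Eq.trans ?_ (Measure.map_comp_of_map_eq_self (hμ W) (measurable_const_mul W)
    (hg.comp (Continuous.prodMk_right Z)).measurable)
  congr 1
  funext O
  have hX : Z * (O : Matrix κ κ ℂ) * E = S * (J * ((W * O : unitaryGroup κ ℂ) : Matrix κ κ ℂ) * E) := by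
    rw [hZW]
    simp only [Submonoid.coe_mul, Matrix.mul_assoc]
  rw [hSS, hX, conjTranspose_mul, hS]
  set K := J * ((W * O : unitaryGroup κ ℂ) : Matrix κ κ ℂ) * E
  -- Cycling the left factor `S` to the right end produces `K Kᴴ S²`, and `S² = Z Zᴴ` does not
  -- involve `W`.
  rw [show c • (S * K * (Kᴴ * S)) = S * (c • (K * Kᴴ * S)) by
    rw [Matrix.mul_smul]; simp only [Matrix.mul_assoc], charpolyValues_mul_comm, Matrix.smul_mul,
    Matrix.mul_assoc (K * Kᴴ)]

omit [DecidableEq κ] in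
/-- By unitary invariance, the law of `K Z Zᴴ` only depends on the eigenvalues of `K`. -/
theorem map_charpolyValues_mul_eq_diagonal {K : Matrix (Fin m) (Fin m) ℂ} (hK : K.IsHermitian) (c : ℂ) :
    (matrixGaussian (Fin m) κ 1).map (fun Z => (c • (K * (Z * Zᴴ))).charpolyValues) =
      (matrixGaussian (Fin m) κ 1).map (fun Z =>
        (c • (diagonal (fun i => (orderedEigenvalues K i : ℂ)) * (Z * Zᴴ))).charpolyValues) := by
  obtain ⟨U, hU, hKU⟩ := hK.exists_eq_conj_orderedEigenvalues
  set Λ := diagonal fun i => (orderedEigenvalues K i : ℂ)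
  have hU' : Uᴴᴴ * Uᴴ = 1 := by rw [conjTranspose_conjTranspose]; exact mul_eq_one_comm.1 hU
  have hm : Measurable fun Z : Matrix (Fin m) κ ℂ => (c • (Λ * (Z * Zᴴ))).charpolyValues :=
    (continuous_charpolyValues.comp ((continuous_const.matrix_mul
      (continuous_id.matrix_mul continuous_id.matrix_conjTranspose)).const_smul c)).measurable
  -- With `K = U Λ Uᴴ`, cycling `U` turns `Z` into `Uᴴ Z`, which is again standard Gaussian.
  refine Eq.trans ?_ (Measure.map_comp_of_map_eq_self (matrixGaussian_one_map_mul_left _ hU')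
    (continuous_const.matrix_mul continuous_id).measurable hm)
  congr 1
  funext Z
  rw [hKU, Matrix.mul_assoc, Matrix.mul_assoc, ← Matrix.mul_smul, charpolyValues_mul_comm,
    Matrix.smul_mul, conjTranspose_mul, conjTranspose_conjTranspose]
  simp only [Matrix.mul_assoc]

end beta

/-- The ordered eigenvalues of a Hermitian matrix are a measurable function of the values of its
characteristic polynomial. -/
theorem exists_measurable_orderedEigenvalues (m : ℕ) :
    ∃ Φ : (ℕ → ℂ) → Fin m → ℝ, Measurable Φ ∧
      ∀ A : Matrix (Fin m) (Fin m) ℂ, A.IsHermitian → Φ A.charpolyValues = orderedEigenvalues A := by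
  obtain ⟨Φ, hΦ, h⟩ := exists_measurable_orderedRoots m
  refine ⟨Φ, hΦ, fun A hA => ?_⟩
  rw [← h _ hA.antitone_orderedEigenvalues]
  congr 1
  funext k
  simp [charpolyValues, hA.charpoly_eq_prod_orderedEigenvalues, Polynomial.eval_prod]

theorem Measurable.charpolyValues_smul_diagonal_mul {α : Type*} [MeasurableSpace α] {m : ℕ}
    {κ : Type*} [Fintype κ] (c : ℂ) {v : α → Fin m → ℝ} (hv : Measurable v)
    {Z : α → Matrix (Fin m) κ ℂ} (hZ : Measurable Z) :
    Measurable fun a =>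
      (c • (diagonal (fun i => (v a i : ℂ)) * (Z a * (Z a)ᴴ))).charpolyValues := by
  have h1 : Continuous fun w : Fin m → ℝ => diagonal fun i => (w i : ℂ) :=
    Continuous.matrix_diagonal (by fun_prop)
  have h2 : Continuous fun X : Matrix (Fin m) κ ℂ => X * Xᴴ :=
    continuous_id.matrix_mul continuous_id.matrix_conjTranspose
  exact continuous_charpolyValues.measurable.comp
    (((h1.measurable.comp hv).matrix_mul (h2.measurable.comp hZ)).const_smul c)

section beta

variable {m : ℕ} {κ κ₁ : Type*} [Fintype κ] [DecidableEq κ] [Fintype κ₁]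

omit [DecidableEq κ] in
/-- In the law of `K Z Zᴴ` with `K` independent of `Z`, the Hermitian matrix `K` may be replaced by
the diagonal matrix of its eigenvalues. -/
theorem map_charpolyValues_diagonal_orderedEigenvalues {α : Type*} [MeasurableSpace α]
    {μ : Measure α} [IsProbabilityMeasure μ] {K : α → Matrix (Fin m) (Fin m) ℂ} (hK : Measurable K)
    (hKH : ∀ a, (K a).IsHermitian) {Φ : (ℕ → ℂ) → Fin m → ℝ} (hΦ : Measurable Φ)
    (hΦA : ∀ A : Matrix (Fin m) (Fin m) ℂ, A.IsHermitian →
      Φ A.charpolyValues = orderedEigenvalues A) (c : ℂ) :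
    (((μ.map fun a => (K a).charpolyValues).map Φ).prod (matrixGaussian (Fin m) κ 1)).map
        (fun q => (c • (diagonal (fun i => (q.1 i : ℂ)) * (q.2 * q.2ᴴ))).charpolyValues) =
      ((matrixGaussian (Fin m) κ 1).prod μ).map
        (fun q => (c • (K q.2 * (q.1 * q.1ᴴ))).charpolyValues) := by
  set γ := matrixGaussian (Fin m) κ 1
  have hKF : Measurable fun a => (K a).charpolyValues :=
    continuous_charpolyValues.measurable.comp hK
  have hδ : (μ.map fun a => (K a).charpolyValues).map Φ =
      μ.map fun a => orderedEigenvalues (K a) := by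
    rw [Measure.map_map hΦ hKF]
    congr 1
    funext a
    exact hΦA _ (hKH a)
  have hKe : Measurable fun a => orderedEigenvalues (K a) := by
    convert hΦ.comp hKF using 1
    funext a
    exact (hΦA _ (hKH a)).symm
  have hm := Measurable.charpolyValues_smul_diagonal_mul (κ := κ) c
    (measurable_fst (α := Fin m → ℝ)) measurable_snd
  have hmK : Measurable fun q : α × Matrix (Fin m) κ ℂ => (c •
      (diagonal (fun i => (orderedEigenvalues (K q.1) i : ℂ)) * (q.2 * q.2ᴴ))).charpolyValues :=
    Measurable.charpolyValues_smul_diagonal_mul c (hKe.comp measurable_fst) measurable_snd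
  have hg : Measurable fun q : Matrix (Fin m) κ ℂ × α =>
      (c • (K q.2 * (q.1 * q.1ᴴ))).charpolyValues :=
    continuous_charpolyValues.measurable.comp (((hK.comp measurable_snd).matrix_mul
      (measurable_fst.matrix_mul (continuous_id.matrix_conjTranspose.measurable.comp
        measurable_fst))).const_smul c)
  have h1 : ((μ.map fun a => orderedEigenvalues (K a)).prod γ) =
      (μ.prod γ).map (Prod.map (fun a => orderedEigenvalues (K a)) id) := by
    rw [← Measure.map_prod_map _ _ hKe measurable_id, Measure.map_id]
  rw [hδ, h1, ← Measure.prod_swap (μ := μ)]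
  refine (Measure.map_map hm (hKe.prodMap measurable_id)).trans
    (Eq.trans ?_ (Measure.map_map hg measurable_swap).symm)
  exact Measure.map_prod_congr hmK (hg.comp measurable_swap)
    (.of_forall fun a => (map_charpolyValues_mul_eq_diagonal (hKH a) c).symm)

/-- The eigenvalues of the product of a Wishart matrix by an independent diagonal matrix of beta
eigenvalues are those of a Wishart matrix with fewer degrees of freedom. -/
theorem map_charpolyValues_diagonal_beta {Φ : (ℕ → ℂ) → Fin m → ℝ} (hΦ : Measurable Φ)
    (hΦA : ∀ A : Matrix (Fin m) (Fin m) ℂ, A.IsHermitian →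
      Φ A.charpolyValues = orderedEigenvalues A)
    (E : Matrix κ κ₁ ℂ) (c : ℂ)
    (hγ : ∀ᵐ Z ∂matrixGaussian (Fin m) κ 1, IsUnit (Z * Zᴴ).det) :
    ((((matrixGaussian (Fin m) κ 1).map
        (fun Z => ((Z * Zᴴ)⁻¹ * ((Z * E) * (Z * E)ᴴ)).charpolyValues)).map Φ).prod
          (matrixGaussian (Fin m) κ 1)).map
        (fun q => (c • (diagonal (fun i => (q.1 i : ℂ)) * (q.2 * q.2ᴴ))).charpolyValues) =
      (matrixGaussian (Fin m) κ 1).map (fun Z => (c • ((Z * E) * (Z * E)ᴴ)).charpolyValues) := by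
  obtain ⟨μ, hμ, hinv⟩ := Matrix.exists_invariant_measure_unitaryGroup κ
  -- A frame `J` with orthonormal rows is the polar part of any sample of full row rank; its
  -- existence encodes `m ≤ card κ`.
  obtain ⟨Z₀, hZ₀⟩ := hγ.exists
  obtain ⟨-, J, -, -, hJ, -⟩ := exists_polar hZ₀
  rw [map_charpolyValues_beta μ hinv E hJ hγ, map_charpolyValues_wishart μ hinv E hJ c hγ]
  exact map_charpolyValues_diagonal_orderedEigenvalues
    ((continuous_gram E).comp (continuous_const.matrix_mul continuous_subtype_val)).measurable
    (fun _ => isHermitian_mul_conjTranspose_self _) hΦ hΦA c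

end beta

/-! ### Column blocks and the Beta law in terms of one Gaussian matrix -/

section columns

variable {ι κ : Type*} [Fintype ι] [Fintype κ]

theorem matrixGaussian_map_reindex {κ' : Type*} [Fintype κ'] (v : ℝ≥0) (e : κ ≃ κ') :
    (matrixGaussian ι κ v).map (fun Z => Z.submatrix id e.symm) = matrixGaussian ι κ' v := by
  let F : (ι × κ → ℂ) → ι × κ' → ℂ := fun x q => x (q.1, e.symm q.2)
  have hF : Measurable F := measurable_pi_lambda _ fun q => measurable_pi_apply (q.1, e.symm q.2)
  have h : (Measure.pi fun _ : ι × κ' => complexGaussian v) =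
      (Measure.pi fun _ : ι × κ => complexGaussian v).map F := by
    refine Measure.pi_eq fun s hs => ?_
    rw [Measure.map_apply hF (MeasurableSet.univ_pi hs)]
    have : F ⁻¹' Set.univ.pi s = Set.univ.pi fun q : ι × κ => s (q.1, e q.2) := by
      ext x
      simp only [F, Set.mem_pi, Set.mem_preimage, Set.mem_univ, forall_const, Prod.forall]
      exact forall_congr' fun i => (e.forall_congr (by simp)).symm
    rw [this, Measure.pi_pi]
    exact Fintype.prod_equiv ((Equiv.refl ι).prodCongr e) _ _ fun q => rfl
  have hs : Measurable fun Z : Matrix ι κ ℂ => Z.submatrix id e.symm :=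
    (continuous_id.matrix_submatrix id e.symm).measurable
  rw [matrixGaussian, matrixGaussian, h]
  exact (Measure.map_map hs measurable_of_prod).trans (Measure.map_map measurable_of_prod hF).symm

omit [Fintype ι] in
theorem Matrix.mul_fromRows_one_zero {κ' : Type*} [Fintype κ'] [DecidableEq κ]
    (Z : Matrix ι (κ ⊕ κ') ℂ) : Z * (fromRows 1 0 : Matrix (κ ⊕ κ') κ ℂ) = Z.toCols₁ := by
  conv_lhs => rw [← fromCols_toCols Z]
  rw [fromCols_mul_fromRows, Matrix.mul_one, Matrix.mul_zero, add_zero]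

omit [Fintype ι] in
theorem Matrix.toCols_gram_add {κ' : Type*} [Fintype κ'] (Z : Matrix ι (κ ⊕ κ') ℂ) :
    Z.toCols₁ * Z.toCols₁ᴴ + Z.toCols₂ * Z.toCols₂ᴴ = Z * Zᴴ := by
  conv_rhs => rw [← fromCols_toCols Z]
  rw [conjTranspose_fromCols_eq_fromRows_conjTranspose, fromCols_mul_fromRows]

end columns

open scoped MatrixOrder in
theorem Matrix.PosDef.isUnit_det_sqrt {n : Type*} [Fintype n] [DecidableEq n] {S : Matrix n n ℂ}
    (hS : S.PosDef) : IsUnit (CFC.sqrt S).det := by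
  have h : CFC.sqrt S * CFC.sqrt S = S :=
    CFC.sqrt_mul_sqrt_self _ (Matrix.nonneg_iff_posSemidef.2 hS.posSemidef)
  have h2 := hS.det_pos.ne'
  rw [← h, det_mul] at h2
  exact (left_ne_zero_of_mul h2).isUnit

open scoped MatrixOrder in
/-- The joint law of two independent Wishart matrices with the same covariance. -/
theorem complexWishart_prod_eq_map {m : ℕ} (p n : ℕ) (S : Matrix (Fin m) (Fin m) ℂ) :
    (complexWishart p S).prod (complexWishart n S) =
      (matrixGaussian (Fin m) (Fin p ⊕ Fin n) 1).map fun Z =>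
        ((CFC.sqrt S * Z.toCols₁) * (CFC.sqrt S * Z.toCols₁)ᴴ,
          (CFC.sqrt S * Z.toCols₂) * (CFC.sqrt S * Z.toCols₂)ᴴ) := by
  have hw : ∀ k : ℕ, Measurable fun Z : Matrix (Fin m) (Fin k) ℂ =>
      (CFC.sqrt S * Z) * (CFC.sqrt S * Z)ᴴ := fun k =>
    ((continuous_const.matrix_mul continuous_id).matrix_mul
      (continuous_const.matrix_mul continuous_id).matrix_conjTranspose).measurable
  have hc : Measurable fun Z : Matrix (Fin m) (Fin p ⊕ Fin n) ℂ => (Z.toCols₁, Z.toCols₂) :=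
    ((continuous_id.matrix_submatrix id Sum.inl).prodMk
      (continuous_id.matrix_submatrix id Sum.inr)).measurable
  rw [complexWishart_eq_map, complexWishart_eq_map, Measure.map_prod_map _ _ (hw p) (hw n),
    ← matrixGaussian_map_toCols]
  exact Measure.map_map ((hw p).prodMap (hw n)) hc

/-- The determinant is the product of the positive diagonal entries. This is the source of the
almost sure full rank of the Gaussian matrix. -/
theorem IsCholeskyFactor.isUnit_det {m : ℕ} {R Q : Matrix (Fin m) (Fin m) ℂ}
    (h : IsCholeskyFactor R Q) : IsUnit R.det := by
  rw [det_of_isUpperTriangular (M := R) fun i j hij => h.upper i j hij, isUnit_iff_ne_zero,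
    Finset.prod_ne_zero_iff]
  intro i _ h0
  have := (h.diag_pos i).1
  rw [h0] at this
  simp at this

/-- The eigenvalues of a beta matrix, expressed through Gaussian matrices. -/
theorem IsComplexMatrixBeta.map_orderedEigenvalues {m p n : ℕ}
    {ζ : Measure (Matrix (Fin m) (Fin m) ℂ)} (hζ : IsComplexMatrixBeta p n ζ)
    (hm : AEMeasurable orderedEigenvalues ζ)
    {Φ : (ℕ → ℂ) → Fin m → ℝ} (hΦ : Measurable Φ)
    (hΦA : ∀ A : Matrix (Fin m) (Fin m) ℂ, A.IsHermitian →
      Φ A.charpolyValues = orderedEigenvalues A) :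
    (∀ᵐ Z ∂matrixGaussian (Fin m) (Fin p ⊕ Fin n) 1, IsUnit (Z * Zᴴ).det) ∧
      ζ.map orderedEigenvalues = ((matrixGaussian (Fin m) (Fin p ⊕ Fin n) 1).map fun Z =>
        ((Z * Zᴴ)⁻¹ * ((Z * (fromRows 1 0 : Matrix (Fin p ⊕ Fin n) (Fin p) ℂ)) *
          (Z * (fromRows 1 0 : Matrix (Fin p ⊕ Fin n) (Fin p) ℂ))ᴴ)).charpolyValues).map Φ := by
  obtain ⟨-, -, S, hS, Ω, _, P, _, A, B, R, hA, hB, hAB, hR, hRC, hC⟩ := hζ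
  set γ := matrixGaussian (Fin m) (Fin p ⊕ Fin n) 1
  have hABm : AEMeasurable (fun ω => (A ω, B ω)) P := hA.aemeasurable.prodMk hB.aemeasurable
  set s : Matrix (Fin m) (Fin m) ℂ := open scoped MatrixOrder in CFC.sqrt S
  have hs : IsUnit s.det := hS.isUnit_det_sqrt
  have hsH : sᴴ = s := by
    open scoped MatrixOrder in
    exact (Matrix.nonneg_iff_posSemidef.1 (CFC.sqrt_nonneg S)).1
  let W : Matrix (Fin m) (Fin p ⊕ Fin n) ℂ → Matrix (Fin m) (Fin m) ℂ × Matrix (Fin m) (Fin m) ℂ :=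
    fun Z => ((s * Z.toCols₁) * (s * Z.toCols₁)ᴴ, (s * Z.toCols₂) * (s * Z.toCols₂)ᴴ)
  have hW : Measurable W := by
    have h1 : Continuous fun Z : Matrix (Fin m) (Fin p ⊕ Fin n) ℂ => s * Z.toCols₁ :=
      continuous_const.matrix_mul (continuous_id.matrix_submatrix id Sum.inl)
    have h2 : Continuous fun Z : Matrix (Fin m) (Fin p ⊕ Fin n) ℂ => s * Z.toCols₂ :=
      continuous_const.matrix_mul (continuous_id.matrix_submatrix id Sum.inr)
    exact ((h1.matrix_mul h1.matrix_conjTranspose).prodMk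
      (h2.matrix_mul h2.matrix_conjTranspose)).measurable
  have hsum : ∀ Z, (W Z).1 + (W Z).2 = s * (Z * Zᴴ) * s := by
    intro Z
    simp only [W, conjTranspose_mul, hsH]
    rw [← Z.toCols_gram_add, Matrix.mul_add, Matrix.add_mul]
    simp only [Matrix.mul_assoc]
  have hW1 : ∀ Z, (W Z).1 = s * ((Z * (fromRows 1 0 : Matrix (Fin p ⊕ Fin n) (Fin p) ℂ)) *
          (Z * (fromRows 1 0 : Matrix (Fin p ⊕ Fin n) (Fin p) ℂ))ᴴ) * s := by
    intro Z
    rw [Matrix.mul_fromRows_one_zero]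
    simp only [W, conjTranspose_mul, hsH, Matrix.mul_assoc]
  have hlawW : P.map (fun ω => (A ω, B ω)) = γ.map W := by
    rw [(indepFun_iff_map_prod_eq_prod_map_map hA.aemeasurable hB.aemeasurable).1 hAB, hA.map_eq,
      hB.map_eq]
    exact complexWishart_prod_eq_map p n S
  -- Needed because `orderedEigenvalues` is `0` off the Hermitian matrices; `A` is known only
  -- through its law, hence almost surely.
  have hherm : ∀ᵐ ω ∂P, (A ω).IsHermitian := by
    have hms : MeasurableSet {q : Matrix (Fin m) (Fin m) ℂ × Matrix (Fin m) (Fin m) ℂ |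
        q.1.IsHermitian} :=
      (isClosed_eq continuous_fst.matrix_conjTranspose continuous_fst).measurableSet
    refine (ae_map_iff hABm hms).1 ?_
    rw [hlawW, ae_map_iff hW.aemeasurable hms]
    exact .of_forall fun Z => isHermitian_mul_conjTranspose_self _
  refine ⟨?_, ?_⟩
  -- The Cholesky factor makes `A + B` almost surely invertible, and `A + B` has the law of `s (Z
  -- Zᴴ) s`.
  · have hms : MeasurableSet {q : Matrix (Fin m) (Fin m) ℂ × Matrix (Fin m) (Fin m) ℂ |
        IsUnit (q.1 + q.2).det} := by
      simp only [isUnit_iff_ne_zero]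
      exact ((continuous_fst.add continuous_snd).matrix_det.measurable
        (measurableSet_singleton 0)).compl
    have h1 : ∀ᵐ q ∂P.map (fun ω => (A ω, B ω)), IsUnit (q.1 + q.2).det := by
      refine (ae_map_iff hABm hms).2 ?_
      filter_upwards [hRC] with ω hω
      rw [← hω.eq, det_mul, det_conjTranspose]
      exact hω.isUnit_det.star.mul hω.isUnit_det
    rw [hlawW, ae_map_iff hW.aemeasurable hms] at h1
    filter_upwards [h1] with Z hZ
    rw [hsum, det_mul, det_mul] at hZ
    exact isUnit_of_mul_isUnit_right (isUnit_of_mul_isUnit_left hZ)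
  · rw [← hC.map_eq] at hm ⊢
    rw [AEMeasurable.map_map_of_aemeasurable hm hC.aemeasurable]
    have hgm : Measurable fun q : Matrix (Fin m) (Fin m) ℂ × Matrix (Fin m) (Fin m) ℂ =>
        Φ ((q.1 + q.2)⁻¹ * q.1).charpolyValues :=
      hΦ.comp (continuous_charpolyValues.measurable.comp
        ((Matrix.measurable_inv.comp (continuous_fst.add continuous_snd).measurable).matrix_mul
          measurable_fst))
    -- Cyclically, `R⁻¹ (Rᴴ)⁻¹ A = (A + B)⁻¹ A`, so the spectrum depends on `(A, B)` alone and `R`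
    -- disappears.
    have h1 : P.map (orderedEigenvalues ∘ fun ω => ((R ω)ᴴ)⁻¹ * A ω * (R ω)⁻¹) =
        P.map (fun ω => Φ ((A ω + B ω)⁻¹ * A ω).charpolyValues) := by
      refine Measure.map_congr ?_
      filter_upwards [hRC, hherm] with ω hω hAω
      rw [Function.comp_apply, ← hΦA, charpolyValues_mul_comm, ← hω.eq, Matrix.mul_inv_rev,
        Matrix.mul_assoc]
      rw [IsHermitian, conjTranspose_mul, conjTranspose_mul, conjTranspose_nonsing_inv,
        conjTranspose_nonsing_inv, conjTranspose_conjTranspose, hAω.eq, Matrix.mul_assoc]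
    have h2 : P.map (fun ω => Φ ((A ω + B ω)⁻¹ * A ω).charpolyValues) =
        γ.map (fun Z => Φ (((W Z).1 + (W Z).2)⁻¹ * (W Z).1).charpolyValues) := by
      refine (AEMeasurable.map_map_of_aemeasurable hgm.aemeasurable hABm).symm.trans ?_
      rw [hlawW]
      exact Measure.map_map hgm hW
    rw [h1, h2, Measure.map_map hΦ (measurable_charpolyValues_inv_mul _)]
    congr 1
    funext Z
    rw [hsum, hW1, Function.comp_apply]
    congr 1
    set X := (Z * (fromRows 1 0 : Matrix (Fin p ⊕ Fin n) (Fin p) ℂ)) *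
          (Z * (fromRows 1 0 : Matrix (Fin p ⊕ Fin n) (Fin p) ℂ))ᴴ
    -- `(s Z Zᴴ s)⁻¹ (s X s)` is similar to `(Z Zᴴ)⁻¹ X`, so the covariance drops out.
    rw [← Matrix.charpolyValues_conj (mul_nonsing_inv s hs) ((Z * Zᴴ)⁻¹ * X), Matrix.mul_inv_rev,
      Matrix.mul_inv_rev]
    simp only [Matrix.mul_assoc]
    rw [← Matrix.mul_assoc s⁻¹ s, nonsing_inv_mul _ hs, Matrix.one_mul]

/-! ### Transfer to singular values and conclusion -/

/-- Random matrices whose Gram matrices have characteristic polynomials with the same law have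
singular values with the same law. -/
theorem identDistrib_orderedSingularValues {Ω Ω' : Type*} [MeasurableSpace Ω] [MeasurableSpace Ω']
    {P : Measure Ω} {P' : Measure Ω'} {m n n' : ℕ} (hn : m ≤ n) (hn' : m ≤ n')
    {X : Ω → Matrix (Fin m) (Fin n) ℂ} {Y : Ω' → Matrix (Fin m) (Fin n') ℂ}
    (hX : AEMeasurable X P) (hY : AEMeasurable Y P')
    (h : P.map (fun ω => (X ω * (X ω)ᴴ).charpolyValues) =
      P'.map (fun ω => (Y ω * (Y ω)ᴴ).charpolyValues)) :
    IdentDistrib (fun ω => orderedSingularValues (X ω)) (fun ω => orderedSingularValues (Y ω))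
      P P' := by
  obtain ⟨Φ, hΦ, hΦA⟩ := exists_measurable_orderedEigenvalues m
  have hmeas : ∀ k, Measurable fun Z : Matrix (Fin m) (Fin k) ℂ => (Z * Zᴴ).charpolyValues :=
    fun k => (continuous_charpolyValues.comp
      (continuous_id.matrix_mul continuous_id.matrix_conjTranspose)).measurable
  have hident : IdentDistrib (fun ω => (X ω * (X ω)ᴴ).charpolyValues)
      (fun ω => (Y ω * (Y ω)ᴴ).charpolyValues) P P' :=
    ⟨(hmeas n).comp_aemeasurable hX, (hmeas n').comp_aemeasurable hY, h⟩
  have hΘ : Measurable fun c : ℕ → ℂ => fun i => √(Φ c i) :=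
    measurable_pi_lambda _ fun i => ((measurable_pi_apply i).comp hΦ).sqrt
  convert hident.comp hΘ using 1
  · funext ω i
    rw [orderedSingularValues_eq_sqrt hn, ← hΦA _ (isHermitian_mul_conjTranspose_self _)]
    rfl
  · funext ω i
    rw [orderedSingularValues_eq_sqrt hn', ← hΦA _ (isHermitian_mul_conjTranspose_self _)]
    rfl

/-- The law of the characteristic polynomial of `D H (D H)ᴴ`, where `D = √c diag(d)`. -/
theorem map_charpolyValues_diagonal_mul {Ω : Type*} [MeasurableSpace Ω] {P : Measure Ω}
    [IsProbabilityMeasure P] {M N : ℕ} {c : ℝ} (hc : 0 < c) {D : Ω → Matrix (Fin M) (Fin M) ℂ}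
    {d : Ω → Fin M → ℝ} (hd : AEMeasurable d P)
    (hD : ∀ᵐ ω ∂P, D ω = diagonal fun i => ((√c * d ω i : ℝ) : ℂ))
    {H : Ω → Matrix (Fin M) (Fin N) ℂ} (hH : HasIIDComplexGaussianEntries H 1 P)
    (hDH : IndepFun D H P) :
    P.map (fun ω => ((D ω * H ω) * (D ω * H ω)ᴴ).charpolyValues) =
      ((P.map fun ω i => d ω i ^ 2).prod (matrixGaussian (Fin M) (Fin N) 1)).map
        (fun q => ((c : ℂ) • (diagonal (fun i => (q.1 i : ℂ)) * (q.2 * q.2ᴴ))).charpolyValues) := by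
  have hd2 : AEMeasurable (fun ω i => d ω i ^ 2) P := by fun_prop
  -- Independence of `H` is assumed for `D`, not for `d`; it passes to `d²` because `d²` is almost
  -- surely a function of `D`.
  let g : Matrix (Fin M) (Fin M) ℂ → Fin M → ℝ := fun A i => (A i i).re ^ 2 / c
  have hg : Measurable g := by
    refine measurable_pi_lambda _ fun i => ?_
    have h : Measurable fun A : Matrix (Fin M) (Fin M) ℂ => A i i :=
      (measurable_pi_apply i).comp (measurable_pi_apply i)
    exact ((Complex.measurable_re.comp h).pow_const 2).div_const c
  have hgD : g ∘ D =ᵐ[P] fun ω i => d ω i ^ 2 := by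
    filter_upwards [hD] with ω hω
    funext i
    simp only [g, Function.comp_apply, hω, diagonal_apply_eq, Complex.ofReal_re]
    rw [mul_pow, Real.sq_sqrt hc.le]
    field_simp
  have hind : IndepFun (fun ω i => d ω i ^ 2) H P :=
    (hDH.comp hg measurable_id).congr hgD (.refl _ _)
  have hlaw := (indepFun_iff_map_prod_eq_prod_map_map hd2 hH.aemeasurable).1 hind
  rw [hH.map_eq] at hlaw
  have hm := Measurable.charpolyValues_smul_diagonal_mul (κ := Fin N) (c : ℂ)
    (measurable_fst (α := Fin M → ℝ)) measurable_snd
  rw [← hlaw, AEMeasurable.map_map_of_aemeasurable hm.aemeasurable (hd2.prodMk hH.aemeasurable)]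
  refine Measure.map_congr ?_
  filter_upwards [hD] with ω hω
  have hDD : (D ω)ᴴ * D ω = (c : ℂ) • diagonal fun i => ((d ω i ^ 2 : ℝ) : ℂ) := by
    rw [hω, diagonal_conjTranspose, diagonal_mul_diagonal, ← diagonal_smul]
    congr 1
    funext i
    simp only [Pi.star_apply, Pi.smul_apply, smul_eq_mul, Complex.star_def, Complex.conj_ofReal]
    norm_cast
    rw [mul_mul_mul_comm, Real.mul_self_sqrt hc.le, sq]
  simp only [Function.comp_apply]
  rw [← Matrix.smul_mul, ← hDD, Matrix.mul_assoc ((D ω)ᴴ), charpolyValues_mul_comm ((D ω)ᴴ),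
    conjTranspose_mul]
  simp only [Matrix.mul_assoc]

/-- The law of the characteristic polynomial of the Gram matrix of a scaled Gaussian matrix. -/
theorem HasIIDComplexGaussianEntries.map_charpolyValues {Ω : Type*} [MeasurableSpace Ω]
    {P : Measure Ω} [IsProbabilityMeasure P] {m n : ℕ} {v : ℝ≥0}
    {G : Ω → Matrix (Fin m) (Fin n) ℂ} (hG : HasIIDComplexGaussianEntries G v P) :
    P.map (fun ω => (G ω * (G ω)ᴴ).charpolyValues) =
      (matrixGaussian (Fin m) (Fin n) 1).map
        (fun Z => (((v : ℝ) : ℂ) • (Z * Zᴴ)).charpolyValues) := by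
  have hm : Measurable fun Z : Matrix (Fin m) (Fin n) ℂ => (Z * Zᴴ).charpolyValues :=
    (continuous_charpolyValues.comp
      (continuous_id.matrix_mul continuous_id.matrix_conjTranspose)).measurable
  refine (AEMeasurable.map_map_of_aemeasurable hm.aemeasurable hG.aemeasurable).symm.trans ?_
  rw [hG.map_eq, ← map_smul_matrixGaussian_one]
  refine (Measure.map_map hm (continuous_const_smul _).measurable).trans ?_
  congr 1
  funext Z
  simp only [Function.comp_apply, conjTranspose_smul, Matrix.smul_mul, Matrix.mul_smul, smul_smul,
    Complex.star_def, Complex.conj_ofReal]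
  rw [← Complex.ofReal_mul, Real.mul_self_sqrt v.coe_nonneg]

/-- Relabelling the columns of the Gaussian matrix. -/
theorem map_charpolyValues_diagonal_mul_reindex {m : ℕ} {κ κ' : Type*} [Fintype κ] [Fintype κ']
    (e : κ ≃ κ') (δ : Measure (Fin m → ℝ)) [SFinite δ] (c : ℂ) :
    (δ.prod (matrixGaussian (Fin m) κ 1)).map
        (fun q => (c • (diagonal (fun i => (q.1 i : ℂ)) * (q.2 * q.2ᴴ))).charpolyValues) =
      (δ.prod (matrixGaussian (Fin m) κ' 1)).map
        (fun q => (c • (diagonal (fun i => (q.1 i : ℂ)) * (q.2 * q.2ᴴ))).charpolyValues) := by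
  have hs : Measurable fun Z : Matrix (Fin m) κ ℂ => Z.submatrix id e.symm :=
    (continuous_id.matrix_submatrix id e.symm).measurable
  have hm := Measurable.charpolyValues_smul_diagonal_mul (κ := κ') c
    (measurable_fst (α := Fin m → ℝ)) measurable_snd
  have h : δ.prod (matrixGaussian (Fin m) κ' 1) = (δ.prod (matrixGaussian (Fin m) κ 1)).map
      (Prod.map id fun Z => Z.submatrix id e.symm) := by
    rw [← Measure.map_prod_map _ _ measurable_id hs, Measure.map_id, matrixGaussian_map_reindex]
  rw [h]
  refine Eq.trans ?_ (Measure.map_map hm (measurable_id.prodMap hs)).symm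
  congr 1
  funext q
  simp only [Function.comp_apply, Prod.map_fst, Prod.map_snd, id_eq, conjTranspose_submatrix,
    submatrix_mul_equiv, submatrix_id_id]

theorem matrixGaussian_map_toCols₁ {ι κ κ' : Type*} [Fintype ι] [Fintype κ] [Fintype κ'] (v : ℝ≥0) :
    (matrixGaussian ι (κ ⊕ κ') v).map (fun Z => Z.toCols₁) = matrixGaussian ι κ v := by
  have hc : Measurable fun Z : Matrix ι (κ ⊕ κ') ℂ => (Z.toCols₁, Z.toCols₂) :=
    ((continuous_id.matrix_submatrix id Sum.inl).prodMk
      (continuous_id.matrix_submatrix id Sum.inr)).measurable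
  have h := congrArg (Measure.map Prod.fst) (matrixGaussian_map_toCols (ι := ι) (κ := κ) (κ' := κ') v)
  rw [Measure.map_map measurable_fst hc, Measure.map_fst_prod] at h
  simpa [Function.comp_def] using h

theorem lemma6 {Ω Ω' : Type*} [MeasurableSpace Ω] [MeasurableSpace Ω']
    (P : Measure Ω) [IsProbabilityMeasure P] (P' : Measure Ω') [IsProbabilityMeasure P']
    (T M N : ℕ) (hM : 0 < M) (hMNT : M ≤ min N (T / 2))
    (D : Ω → Matrix (Fin M) (Fin M) ℂ) (hD : HasOptimalDiagonalLaw T M N D P)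
    (H : Ω → Matrix (Fin M) (Fin N) ℂ) (hH : HasIIDComplexGaussianEntries H 1 P)
    (hDH : IndepFun D H P)
    (G : Ω' → Matrix (Fin M) (Fin (min N (T - M))) ℂ)
    (hG : HasIIDComplexGaussianEntries G ((T * N : ℝ≥0) / (min N (T - M) : ℕ)) P') :
    IdentDistrib (fun ω => orderedSingularValues (D ω * H ω))
      (fun ω => orderedSingularValues (G ω)) P P' := by
  obtain ⟨d, hd, -, hDd, hbeta, hone⟩ := hD
  have hL : 0 < min N (T - M) := by omega
  have hc : (0 : ℝ) < (T * N : ℝ) / (min N (T - M) : ℕ) := by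
    have hT : 0 < T := by omega
    have hN : 0 < N := by omega
    positivity
  have hv : (((T * N : ℝ≥0) / (min N (T - M) : ℕ) : ℝ≥0) : ℝ) =
      (T * N : ℝ) / (min N (T - M) : ℕ) := by
    rw [NNReal.coe_div, NNReal.coe_mul, NNReal.coe_natCast, NNReal.coe_natCast,
      NNReal.coe_natCast]
  have hDm : AEMeasurable D P := by
    have h : Continuous fun w : Fin M → ℝ =>
        diagonal fun i => ((√((T * N : ℝ) / (min N (T - M) : ℕ)) * w i : ℝ) : ℂ) :=
      Continuous.matrix_diagonal (by fun_prop)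
    exact (h.measurable.comp_aemeasurable hd).congr (hDd.mono fun ω hω => hω.symm)
  have hDHm : AEMeasurable (fun ω => D ω * H ω) P :=
    (continuous_fst.matrix_mul continuous_snd : Continuous fun q : Matrix (Fin M) (Fin M) ℂ ×
      Matrix (Fin M) (Fin N) ℂ => q.1 * q.2).measurable.comp_aemeasurable
        (hDm.prodMk hH.aemeasurable)
  refine identDistrib_orderedSingularValues (by omega) (by omega) hDHm hG.aemeasurable ?_
  rw [map_charpolyValues_diagonal_mul hc hd hDd hH hDH, hG.map_charpolyValues, hv]
  generalize (T * N : ℝ) / (min N (T - M) : ℕ) = c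
  have hd2 : AEMeasurable (fun ω i => d ω i ^ 2) P := by fun_prop
  have := Measure.isProbabilityMeasure_map hd2
  rcases lt_or_ge T (M + N) with hT | hT
  · obtain ⟨ζ, hζ, hdζ⟩ := hbeta hT
    obtain ⟨Φ, hΦ, hΦA⟩ := exists_measurable_orderedEigenvalues M
    obtain ⟨hγ, hζΦ⟩ := hζ.map_orderedEigenvalues hdζ.aemeasurable_snd hΦ hΦA
    -- The two Beta parameters add up to `N`, so `H` can be identified with the Gaussian matrix
    -- whose first `T - M = L` columns are kept.
    have hN : N = (T - M) + (M + N - T) := by omega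
    rw [min_eq_right (by omega : T - M ≤ N),
      map_charpolyValues_diagonal_mul_reindex ((finCongr hN).trans finSumFinEquiv.symm),
      hdζ.map_eq, hζΦ, map_charpolyValues_diagonal_beta hΦ hΦA _ _ hγ,
      ← matrixGaussian_map_toCols₁ (κ' := Fin (M + N - T)) (κ := Fin (T - M))]
    simp only [Matrix.mul_fromRows_one_zero]
    refine (Measure.map_map
      (g := fun Z : Matrix (Fin M) (Fin (T - M)) ℂ => ((c : ℂ) • (Z * Zᴴ)).charpolyValues)
      ?_ ?_).symm
    · have h : Continuous fun Z : Matrix (Fin M) (Fin (T - M)) ℂ => Z * Zᴴ :=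
        continuous_id.matrix_mul continuous_id.matrix_conjTranspose
      exact (continuous_charpolyValues.comp (h.const_smul (c : ℂ))).measurable
    · exact (continuous_id.matrix_submatrix id Sum.inl).measurable
  -- Here `L = N` and `d²` is a point mass at `1`, so both sides are the law of the spectrum of `c Z
  -- Zᴴ`.
  · rw [min_eq_left (by omega : N ≤ T - M)]
    have h1 : P.map (fun ω i => d ω i ^ 2) = Measure.dirac 1 := by
      rw [Measure.map_congr (g := fun _ => (1 : Fin M → ℝ))]
      · simp
      · filter_upwards [hone hT] with ω hω
        funext i
        simp [hω i]
    have hm := Measurable.charpolyValues_smul_diagonal_mul (κ := Fin N) (c : ℂ)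
      (measurable_fst (α := Fin M → ℝ)) measurable_snd
    rw [h1, Measure.dirac_prod]
    refine (Measure.map_map hm measurable_prodMk_left).trans ?_
    congr 1
    funext Z
    simp
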